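/- Let $n\ge 2$, $1\le\alpha\le n$, $\frac1n\le\beta\le\frac2n$ and $p=2+\frac{n-\alpha}{n-1}\left(\frac2n-\beta\right)$. Let $\mathbb B^{n-1}$ be the unit ball of $\mathbb R^{n-1}$, and for $f\in L^p(\mathbb B^{n-1})$ (complex-valued) let $$Ef(x)=\int_{\mathbb B^{n-1}}e^{-2\pi i x\cdot(\omega,|\omega|^2)}f(\omega)\,d\omega,\qquad x\in\mathbb R^n,$$ be the extension operator of the unit paraboloid. Write $B(x,r)$ for the ball in $\mathbb R^n$ of center $x$ and radius $r$, and $\widetilde B(x,r)$ for the axis-parallel cube in $\mathbb R^n$ of center $x$ and side-length $r$; a lattice unit cube is a cube $\prod_{i=1}^n[k_i,k_i+1]$ with $k\in\mathbb Z^n$. For $R\ge1$ and a union $X=\bigcup_k\widetilde B_k$ of distinct lattice unit cubes $\widetilde B_k\subset\widetilde B(0,R)$ put $$\gamma=\gamma(X,R)=\sup\frac{\#\{\widetilde B_k:\widetilde B_k\subset\widetilde B(x',r)\}}{r^\alpha},$$ the supremum being over all $(x',r)\in\mathbb R^n\times[1,\infty)$ with $\widetilde B(x',r)\subset\widetilde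 B(0,R)$. For a Lebesgue measurable $H:\mathbb R^n\to[0,1]$ put $$A_\alpha(H)=\inf\Big\{C:\int_{B(x_0,r)}H(x)\,dx\le C r^\alpha\ \text{ for all }x_0\in\mathbb R^n,\ r\ge1\Big\},$$ and call $H$ a weight of fractal dimension $\alpha$ if $A_\alpha(H)<\infty$. Then the following two statements are equivalent. (i) For every $\epsilon>0$ there is a constant $C_\epsilon$ (depending only on $n,\alpha,\beta,\epsilon$) such that $$\int_X|Ef(x)|^p\,dx\le C_\epsilon R^\epsilon\gamma^\beta R^{\alpha/n}\|f\|_{L^p(\mathbb B^{n-1})}^p$$ for all $R\ge1$, all unions $X$ of lattice unit cubes in $\widetilde B(0,R)$, and all $f\in L^p(\mathbb B^{n-1})$. (ii) For every $\epsilon>0$ there is a constant $C_\epsilon$ (depending only on $n,\alpha,\beta,\epsilon$) such that $$\int_{B(0,R)}|Ef(x)|^pH(x)\,dx\le C_\epsilon R^\epsilon A_\alpha(H)^\beta R^{\alpha/n}\|f\|_{L^p(\mathbb B^{n-1})}^p$$ for all $R\ge1$, all $f\in L^p(\mathbb B^{n-1})$, and all weights $H$ of fractal dimension $\alpha$. 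-/

import Mathlib

open MeasureTheory
open scoped NNReal ENNReal

noncomputable section

/-- The extension operator of the unit paraboloid in `ℝ^(d+1)`:
`Ef(x) = ∫_{|ω| ≤ 1} exp(-2πi x · (ω, |ω|²)) f(ω) dω`, with `ω` ranging over the unit ball
of `ℝ^d`. -/
def paraboloidExtension {d : ℕ} (f : EuclideanSpace ℝ (Fin d) → ℂ)
    (x : EuclideanSpace ℝ (Fin (d + 1))) : ℂ :=
  ∫ ω in Metric.closedBall (0 : EuclideanSpace ℝ (Fin d)) 1,
    Complex.exp (-2 * Real.pi * Complex.I *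
      (((∑ i : Fin d, x i.castSucc * ω i) + x (Fin.last d) * ‖ω‖ ^ 2 : ℝ) : ℂ)) * f ω

/-- Lebesgue measure on the unit ball of `ℝ^d`. -/
def unitBallMeasure (d : ℕ) : Measure (EuclideanSpace ℝ (Fin d)) :=
  volume.restrict (Metric.closedBall 0 1)

/-- The axis-parallel cube of center `x` and side-length `r` in `ℝ^n`. -/
def cube {n : ℕ} (x : EuclideanSpace ℝ (Fin n)) (r : ℝ) : Set (EuclideanSpace ℝ (Fin n)) :=
  {y | ∀ i, |y i - x i| ≤ r / 2}

/-- The unit cube `∏ [kᵢ, kᵢ + 1]` of the integer lattice. -/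
def latticeCube {n : ℕ} (k : Fin n → ℤ) : Set (EuclideanSpace ℝ (Fin n)) :=
  {y | ∀ i, (k i : ℝ) ≤ y i ∧ y i ≤ k i + 1}

/-- The union of the lattice unit cubes indexed by `S`. -/
def cubeUnion {n : ℕ} (S : Finset (Fin n → ℤ)) : Set (EuclideanSpace ℝ (Fin n)) :=
  ⋃ k ∈ S, latticeCube k

open Classical in
/-- The number of the cubes indexed by `S` that are contained in the set `Q`. -/
def cubeCount {n : ℕ} (S : Finset (Fin n → ℤ)) (Q : Set (EuclideanSpace ℝ (Fin n))) : ℕ :=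
  (S.filter fun k => latticeCube k ⊆ Q).card

/-- The quantity `γ`: the supremum of `#{cubes contained in cube x' r} / r ^ α` over all
`x'` and all `r ≥ 1` with `cube x' r ⊆ cube 0 R`. -/
def cubeGamma {n : ℕ} (α R : ℝ) (S : Finset (Fin n → ℤ)) : ℝ≥0∞ :=
  ⨆ (x' : EuclideanSpace ℝ (Fin n)) (r : ℝ) (_ : 1 ≤ r) (_ : cube x' r ⊆ cube 0 R),
    ENNReal.ofReal (cubeCount S (cube x' r) / r ^ α)

/-- The quantity `A_α(H)`: the infimum of the constants `C` such that
`∫_{B(x₀,r)} H ≤ C r ^ α` for all `x₀` and all `r ≥ 1`; it is `∞` if there is no finite one. -/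
def fractalConst {n : ℕ} (α : ℝ) (H : EuclideanSpace ℝ (Fin n) → ℝ) : ℝ≥0∞ :=
  sInf {C : ℝ≥0∞ | ∀ (x₀ : EuclideanSpace ℝ (Fin n)) (r : ℝ), 1 ≤ r →
    ∫⁻ x in Metric.ball x₀ r, ENNReal.ofReal (H x) ≤ C * ENNReal.ofReal (r ^ α)}

/-- A weight of fractal dimension `α`: a Lebesgue measurable function `H : ℝ^n → [0,1]` with
`A_α(H) < ∞`. (As Lebesgue measure is completed, Lebesgue measurability is a.e.-measurability
for `volume`.) -/
structure IsFractalWeight {n : ℕ} (α : ℝ) (H : EuclideanSpace ℝ (Fin n) → ℝ) : Prop where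
  aemeasurable : AEMeasurable H volume
  mem_Icc : ∀ x, H x ∈ Set.Icc (0 : ℝ) 1
  finite : fractalConst α H < ∞

/-- The lattice-cube estimate in `ℝ^n`, `n = d + 1`: for every `ε > 0` there is a constant `C`
such that for all `R ≥ 1`, all unions `X` of lattice unit cubes in `cube 0 R` and all `f ∈ L^p`,
`∫_X |Ef|^p ≤ C R^ε γ^β R^(α/n) ‖f‖_p^p`. -/
def LatticeEstimate (d : ℕ) (α β p : ℝ) : Prop :=
  ∀ ε : ℝ, 0 < ε → ∃ C : ℝ≥0, ∀ R : ℝ, 1 ≤ R →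
    ∀ S : Finset (Fin (d + 1) → ℤ), (∀ k ∈ S, latticeCube k ⊆ cube 0 R) →
    ∀ f : EuclideanSpace ℝ (Fin d) → ℂ, MemLp f (ENNReal.ofReal p) (unitBallMeasure d) →
      ∫⁻ x in cubeUnion S, ‖paraboloidExtension f x‖ₑ ^ p ≤
        C * ENNReal.ofReal (R ^ ε) * cubeGamma α R S ^ β *
          ENNReal.ofReal (R ^ (α / ((d + 1 : ℕ) : ℝ))) *
          eLpNorm f (ENNReal.ofReal p) (unitBallMeasure d) ^ p

/-- The weighted estimate in `ℝ^n`, `n = d + 1`: for every `ε > 0` there is a constant `C`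
such that for all `R ≥ 1`, all weights `H` of fractal dimension `α` and all `f ∈ L^p`,
`∫_{B(0,R)} |Ef|^p H ≤ C R^ε A_α(H)^β R^(α/n) ‖f‖_p^p`. -/
def WeightedEstimate (d : ℕ) (α β p : ℝ) : Prop :=
  ∀ ε : ℝ, 0 < ε → ∃ C : ℝ≥0, ∀ R : ℝ, 1 ≤ R →
    ∀ H : EuclideanSpace ℝ (Fin (d + 1)) → ℝ, IsFractalWeight α H →
    ∀ f : EuclideanSpace ℝ (Fin d) → ℂ, MemLp f (ENNReal.ofReal p) (unitBallMeasure d) →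
      ∫⁻ x in Metric.ball (0 : EuclideanSpace ℝ (Fin (d + 1))) R,
          ‖paraboloidExtension f x‖ₑ ^ p * ENNReal.ofReal (H x) ≤
        C * ENNReal.ofReal (R ^ ε) * fractalConst α H ^ β *
          ENNReal.ofReal (R ^ (α / ((d + 1 : ℕ) : ℝ))) *
          eLpNorm f (ENNReal.ofReal p) (unitBallMeasure d) ^ p

end

/-! From weights to cubes: take for `H` the indicator of `X`. A lattice cube meeting `B(x₀, r)` lies
in the cube of side `4r` about `x₀`, so `A_α(H) ≤ 4^α γ` (`fractalConst_indicator_cubeUnion_le`),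
and `X` lies in `B(0, nR)`.

From cubes to weights, two ingredients are needed. The first is local constancy at unit scale. Since
the frequencies `(ω, |ω|²)` are bounded, `|Ef|^p` at any point of a unit cube is at most a constant
times a finite sum of integrals over that cube of `|E f_T|^p`, where `f_T` is `f` times a product of
frequencies and `‖f_T‖_p ≲ ‖f‖_p` (`enorm_paraboloidExtension_rpow_le`). Hence only the masses `h_k`
of `H` on the unit cubes matter.

The second is a dyadic decomposition of these masses (`sum_mass_mul_lintegral_le`). The cubes with
`h_k > c` satisfy `γ ≤ n^α A_α(H) / c`, so level `c` contributes about `c · (A_α(H) / c)^β`. For `β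
< 1` this sums geometrically, but `β = 1` can occur when `n = 2`. Therefore a small power `γ^δ` is
estimated by the trivial bound `R^(nδ)` instead, which gives a geometric factor for all `β ≤ 1` and
costs only a factor absorbed in `R^ε`. -/

noncomputable section

/-! ### Geometry and volume of cubes. -/

/-- The half-open unit cube `∏ [kᵢ, kᵢ + 1)` of the integer lattice. -/
def halfOpenCube {n : ℕ} (k : Fin n → ℤ) : Set (EuclideanSpace ℝ (Fin n)) :=
  {y | ∀ i, y i ∈ Set.Ico (k i : ℝ) (k i + 1)}

theorem mem_halfOpenCube_iff_floor {n : ℕ} {k : Fin n → ℤ} {y : EuclideanSpace ℝ (Fin n)} :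
    y ∈ halfOpenCube k ↔ (fun i => ⌊y i⌋) = k := by
  simp only [halfOpenCube, Set.mem_ofPred_eq, Set.mem_Ico, funext_iff, Int.floor_eq_iff]

theorem pairwiseDisjoint_halfOpenCube {n : ℕ} (s : Set (Fin n → ℤ)) :
    s.PairwiseDisjoint halfOpenCube := by
  intro k _ l _ hkl
  refine Set.disjoint_left.2 fun y hk hl => hkl ?_
  rw [mem_halfOpenCube_iff_floor] at hk hl
  exact hk.symm.trans hl

theorem halfOpenCube_eq_preimage {n : ℕ} (k : Fin n → ℤ) :
    halfOpenCube k = WithLp.ofLp ⁻¹'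
      (Set.univ.pi fun i => Set.Ico (k i : ℝ) (k i + 1)) := by
  ext y; simp [halfOpenCube]

theorem measurableSet_halfOpenCube {n : ℕ} (k : Fin n → ℤ) :
    MeasurableSet (halfOpenCube k) := by
  rw [halfOpenCube_eq_preimage]
  exact (PiLp.volume_preserving_ofLp _).measurable
    (MeasurableSet.univ_pi fun _ => measurableSet_Ico)

theorem volume_halfOpenCube {n : ℕ} (k : Fin n → ℤ) : volume (halfOpenCube k) = 1 := by
  rw [halfOpenCube_eq_preimage, (PiLp.volume_preserving_ofLp _).measure_preimage
    (MeasurableSet.univ_pi fun _ => measurableSet_Ico).nullMeasurableSet, Real.volume_pi_Ico]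
  simp

theorem halfOpenCube_subset_latticeCube {n : ℕ} (k : Fin n → ℤ) :
    halfOpenCube k ⊆ latticeCube k := fun _ hy i => ⟨(hy i).1, (hy i).2.le⟩

theorem latticeCube_eq_preimage {n : ℕ} (k : Fin n → ℤ) :
    latticeCube k = WithLp.ofLp ⁻¹'
      (Set.univ.pi fun i => Set.Icc (k i : ℝ) (k i + 1)) := by
  ext y; simp [latticeCube, -Set.pi_univ_Icc]

theorem measurableSet_latticeCube {n : ℕ} (k : Fin n → ℤ) :
    MeasurableSet (latticeCube k) := by
  rw [latticeCube_eq_preimage]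
  exact (PiLp.volume_preserving_ofLp _).measurable
    (MeasurableSet.univ_pi fun _ => measurableSet_Icc)

theorem volume_latticeCube {n : ℕ} (k : Fin n → ℤ) : volume (latticeCube k) = 1 := by
  rw [latticeCube_eq_preimage, (PiLp.volume_preserving_ofLp _).measure_preimage
    (MeasurableSet.univ_pi fun _ => measurableSet_Icc).nullMeasurableSet, Set.pi_univ_Icc,
    Real.volume_Icc_pi]
  simp

theorem measurableSet_cubeUnion {n : ℕ} (S : Finset (Fin n → ℤ)) :
    MeasurableSet (cubeUnion S) :=
  S.measurableSet_biUnion fun k _ => measurableSet_latticeCube k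

theorem volume_cube {n : ℕ} (x : EuclideanSpace ℝ (Fin n)) (r : ℝ) :
    volume (cube x r) = ENNReal.ofReal r ^ n := by
  have h : cube x r = WithLp.ofLp ⁻¹'
      (Set.Icc (fun i => x i - r / 2) (fun i => x i + r / 2)) := by
    ext y
    simp only [cube, Set.mem_ofPred_eq, Set.mem_preimage, Set.mem_Icc, Pi.le_def, abs_le]
    rw [← forall_and]
    refine forall_congr' fun i => ⟨fun h => ⟨?_, ?_⟩, fun h => ⟨?_, ?_⟩⟩ <;> linarith [h.1, h.2]
  rw [h, (PiLp.volume_preserving_ofLp _).measure_preimage measurableSet_Icc.nullMeasurableSet,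
    Real.volume_Icc_pi]
  simp [show ∀ i, x i + r / 2 - (x i - r / 2) = r by intro i; ring]

/-- The factor `n` in place of `√n` costs only a constant; the strict inequality suits the open
balls in `fractalConst`. -/
theorem norm_lt_of_forall_abs_lt {n : ℕ} (hn : 1 ≤ n) {y : EuclideanSpace ℝ (Fin n)} {r : ℝ}
    (h : ∀ i, |y i| < r) : ‖y‖ < n * r := by
  have hn' : (1 : ℝ) ≤ n := by exact_mod_cast hn
  have hr : 0 < r := (abs_nonneg _).trans_lt (h ⟨0, hn⟩)
  refine lt_of_pow_lt_pow_left₀ 2 (by positivity) ?_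
  have : Nonempty (Fin n) := ⟨⟨0, hn⟩⟩
  rw [EuclideanSpace.norm_sq_eq]
  calc ∑ i, ‖y i‖ ^ 2 < ∑ _i : Fin n, r ^ 2 :=
        Finset.sum_lt_sum_of_nonempty Finset.univ_nonempty fun i _ => by
          have := h i
          rw [Real.norm_eq_abs]
          gcongr
    _ = n * r ^ 2 := by simp
    _ ≤ (n * r) ^ 2 := by nlinarith [mul_nonneg (sub_nonneg.2 hn') (sq_nonneg r)]

theorem cube_subset_ball {n : ℕ} (hn : 1 ≤ n) (x : EuclideanSpace ℝ (Fin n)) {r : ℝ}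
    (hr : 0 < r) : cube x r ⊆ Metric.ball x (n * r) := by
  intro y hy
  rw [mem_ball_iff_norm]
  exact norm_lt_of_forall_abs_lt hn fun i => by
    have := hy i
    simp only [PiLp.sub_apply]
    linarith

/-! ### Comparison of `γ` with the fractal constant of a weight. -/

/-- If `G` has mass at least `c` on each cube of `S`, then it has mass at least
`c` times the number of cubes contained in `Q` on `Q`. -/
theorem mul_cubeCount_le_lintegral {n : ℕ} {S : Finset (Fin n → ℤ)}
    {G : EuclideanSpace ℝ (Fin n) → ℝ≥0∞} {c : ℝ≥0∞}
    (hc : ∀ k ∈ S, c ≤ ∫⁻ x in halfOpenCube k, G x) (Q : Set (EuclideanSpace ℝ (Fin n))) :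
    c * cubeCount S Q ≤ ∫⁻ x in Q, G x := by
  classical
  have h1 : c * cubeCount S Q = ∑ k ∈ S.filter fun k => latticeCube k ⊆ Q, c := by
    rw [Finset.sum_const, nsmul_eq_mul, mul_comm]
    unfold cubeCount
    congr!
  rw [h1]
  calc ∑ k ∈ S.filter fun k => latticeCube k ⊆ Q, c
      ≤ ∑ k ∈ S.filter fun k => latticeCube k ⊆ Q, ∫⁻ x in halfOpenCube k, G x :=
        Finset.sum_le_sum fun k hk => hc k (Finset.mem_filter.1 hk).1
    _ = ∫⁻ x in ⋃ k ∈ S.filter fun k => latticeCube k ⊆ Q, halfOpenCube k, G x :=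
        (lintegral_biUnion_finset (pairwiseDisjoint_halfOpenCube _)
          (fun k _ => measurableSet_halfOpenCube k) _).symm
    _ ≤ ∫⁻ x in Q, G x := lintegral_mono_set <| Set.iUnion₂_subset fun k hk =>
        (halfOpenCube_subset_latticeCube k).trans (Finset.mem_filter.1 hk).2

theorem sum_lintegral_halfOpenCube_le {n : ℕ} (S : Finset (Fin n → ℤ))
    (F : EuclideanSpace ℝ (Fin n) → ℝ≥0∞) :
    ∑ k ∈ S, ∫⁻ x in halfOpenCube k, F x ≤ ∫⁻ x in cubeUnion S, F x := by
  rw [← lintegral_biUnion_finset (pairwiseDisjoint_halfOpenCube _)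
    (fun k _ => measurableSet_halfOpenCube k)]
  exact lintegral_mono_set <| Set.iUnion₂_mono fun k _ => halfOpenCube_subset_latticeCube k

/-- The infimum is attained: `r ^ α` is neither `0` nor `∞`, so each constraint is a lower bound for
`C`. -/
theorem lintegral_ball_le_fractalConst {n : ℕ} {α : ℝ} (H : EuclideanSpace ℝ (Fin n) → ℝ)
    (x₀ : EuclideanSpace ℝ (Fin n)) {r : ℝ} (hr : 1 ≤ r) :
    ∫⁻ x in Metric.ball x₀ r, ENNReal.ofReal (H x) ≤
      fractalConst α H * ENNReal.ofReal (r ^ α) := by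
  have h0 : ENNReal.ofReal (r ^ α) ≠ 0 := by
    simpa using Real.rpow_pos_of_pos (by linarith) α
  rw [← ENNReal.div_le_iff h0 ENNReal.ofReal_ne_top]
  refine le_sInf fun C hC => ?_
  rw [ENNReal.div_le_iff h0 ENNReal.ofReal_ne_top]
  exact hC x₀ r hr

theorem le_of_cube_subset_cube {n : ℕ} (hn : 1 ≤ n) {x x' : EuclideanSpace ℝ (Fin n)} {r R : ℝ}
    (hr : 0 ≤ r) (h : cube x' r ⊆ cube x R) : r ≤ R := by
  have h1 : WithLp.toLp 2 (fun i => x' i + r / 2) ∈ cube x' r := fun i => by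
    simp [abs_of_nonneg (div_nonneg hr zero_le_two)]
  have h2 : WithLp.toLp 2 (fun i => x' i - r / 2) ∈ cube x' r := fun i => by
    simp [abs_of_nonneg (div_nonneg hr zero_le_two)]
  have h1 := h h1 ⟨0, hn⟩
  have h2 := h h2 ⟨0, hn⟩
  simp only [abs_le] at h1 h2
  linarith [h1.2, h2.1]

theorem ofReal_cubeCount_div {n : ℕ} (S : Finset (Fin n → ℤ))
    (Q : Set (EuclideanSpace ℝ (Fin n))) {r α : ℝ} (hr : 0 < r) :
    ENNReal.ofReal (cubeCount S Q / r ^ α) = cubeCount S Q / ENNReal.ofReal (r ^ α) := by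
  rw [ENNReal.ofReal_div_of_pos (Real.rpow_pos_of_pos hr α), ENNReal.ofReal_natCast]

theorem cubeCount_le_cubeGamma_mul {n : ℕ} {α R : ℝ} (S : Finset (Fin n → ℤ))
    {x' : EuclideanSpace ℝ (Fin n)} {r : ℝ} (hr : 1 ≤ r) (h : cube x' r ⊆ cube 0 R) :
    (cubeCount S (cube x' r) : ℝ≥0∞) ≤ cubeGamma α R S * ENNReal.ofReal (r ^ α) := by
  have h0 : ENNReal.ofReal (r ^ α) ≠ 0 := by
    simpa using Real.rpow_pos_of_pos (by linarith) α
  rw [← ENNReal.div_le_iff h0 ENNReal.ofReal_ne_top, ← ofReal_cubeCount_div S _ (by linarith)]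
  exact le_iSup_of_le x' <| le_iSup_of_le r <| le_iSup_of_le hr <| le_iSup_of_le h le_rfl

theorem cubeGamma_le_of_forall {n : ℕ} {α R : ℝ} {S : Finset (Fin n → ℤ)} {D : ℝ≥0∞}
    (h : ∀ (x' : EuclideanSpace ℝ (Fin n)) (r : ℝ), 1 ≤ r → cube x' r ⊆ cube 0 R →
      (cubeCount S (cube x' r) : ℝ≥0∞) ≤ D * ENNReal.ofReal (r ^ α)) :
    cubeGamma α R S ≤ D := by
  refine iSup_le fun x' => iSup_le fun r => iSup_le fun hr => iSup_le fun hs => ?_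
  have h0 : ENNReal.ofReal (r ^ α) ≠ 0 := by
    simpa using Real.rpow_pos_of_pos (by linarith) α
  rw [ofReal_cubeCount_div S _ (by linarith), ENNReal.div_le_iff h0 ENNReal.ofReal_ne_top]
  exact h x' r hr hs

/-- Gives the finiteness of `γ`, by which the indicator of a union of cubes is a fractal weight. -/
theorem cubeGamma_le_card {n : ℕ} {α R : ℝ} (hα : 0 ≤ α) (S : Finset (Fin n → ℤ)) :
    cubeGamma α R S ≤ S.card := by
  classical
  refine cubeGamma_le_of_forall fun x' r hr _ => ?_
  have h1 : (1 : ℝ≥0∞) ≤ ENNReal.ofReal (r ^ α) := by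
    simpa using Real.one_le_rpow hr hα
  calc (cubeCount S (cube x' r) : ℝ≥0∞) ≤ S.card := by
        unfold cubeCount
        exact_mod_cast Finset.card_filter_le _ _
    _ ≤ S.card * ENNReal.ofReal (r ^ α) := le_mul_of_one_le_right' h1

/-- Trivial bound for `γ`, by comparison of volumes. -/
theorem cubeGamma_le_ofReal_pow {n : ℕ} (hn : 1 ≤ n) {α R : ℝ} (hα : 0 ≤ α)
    (S : Finset (Fin n → ℤ)) :
    cubeGamma α R S ≤ ENNReal.ofReal R ^ n := by
  refine cubeGamma_le_of_forall fun x' r hr hs => ?_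
  have h1 : (1 : ℝ≥0∞) ≤ ENNReal.ofReal (r ^ α) := by
    simpa using Real.one_le_rpow hr hα
  have h2 := mul_cubeCount_le_lintegral (S := S) (G := fun _ => 1) (c := 1)
    (fun k _ => by simp [volume_halfOpenCube]) (cube x' r)
  rw [one_mul, setLIntegral_one, volume_cube] at h2
  calc (cubeCount S (cube x' r) : ℝ≥0∞) ≤ ENNReal.ofReal r ^ n := h2
    _ ≤ ENNReal.ofReal R ^ n := by
        gcongr
        exact le_of_cube_subset_cube hn (by linarith) hs
    _ ≤ _ := le_mul_of_one_le_right' h1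

/-- If `H` has mass at least `c` on each cube of `S`, then `γ ≤ n ^ α A_α(H) / c`. -/
theorem cubeGamma_le_fractalConst_div {n : ℕ} (hn : 1 ≤ n) {α R : ℝ}
    {S : Finset (Fin n → ℤ)} {H : EuclideanSpace ℝ (Fin n) → ℝ} {c : ℝ≥0∞}
    (hc0 : c ≠ 0) (hc1 : c ≠ ∞)
    (hc : ∀ k ∈ S, c ≤ ∫⁻ x in halfOpenCube k, ENNReal.ofReal (H x)) :
    cubeGamma α R S ≤ ENNReal.ofReal ((n : ℝ) ^ α) * fractalConst α H / c := by
  refine cubeGamma_le_of_forall fun x' r hr hs => ?_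
  have hn' : (1 : ℝ) ≤ n := by exact_mod_cast hn
  rw [← ENNReal.mul_div_right_comm, ENNReal.le_div_iff_mul_le (Or.inl hc0) (Or.inl hc1), mul_comm]
  calc c * (cubeCount S (cube x' r) : ℝ≥0∞)
      ≤ ∫⁻ x in cube x' r, ENNReal.ofReal (H x) := mul_cubeCount_le_lintegral hc _
    _ ≤ ∫⁻ x in Metric.ball x' (n * r), ENNReal.ofReal (H x) :=
        lintegral_mono_set (cube_subset_ball hn x' (by linarith))
    _ ≤ fractalConst α H * ENNReal.ofReal ((n * r) ^ α) :=
        lintegral_ball_le_fractalConst H x' (by nlinarith)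
    _ = _ := by
        rw [Real.mul_rpow (by positivity) (by linarith), ENNReal.ofReal_mul (by positivity)]
        ring

/-- The mass of a weight on a unit cube is at most `n ^ α A_α(H)`. -/
theorem lintegral_halfOpenCube_le_fractalConst {n : ℕ} (hn : 1 ≤ n) {α : ℝ}
    (H : EuclideanSpace ℝ (Fin n) → ℝ) (k : Fin n → ℤ) :
    ∫⁻ x in halfOpenCube k, ENNReal.ofReal (H x) ≤
      ENNReal.ofReal ((n : ℝ) ^ α) * fractalConst α H := by
  rw [mul_comm]
  refine le_trans (lintegral_mono_set ?_) (lintegral_ball_le_fractalConst H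
    (WithLp.toLp 2 fun i => (k i : ℝ) + 1 / 2) (by exact_mod_cast hn))
  intro y hy
  rw [mem_ball_iff_norm]
  have := norm_lt_of_forall_abs_lt hn (y := y - WithLp.toLp 2 fun i => (k i : ℝ) + 1 / 2) (r := 1)
    fun i => by
      have := hy i
      simp only [PiLp.sub_apply, abs_lt]
      constructor <;> linarith [this.1, this.2]
  simpa using this

theorem lintegral_halfOpenCube_le_one {n : ℕ} {H : EuclideanSpace ℝ (Fin n) → ℝ}
    (hH : ∀ x, H x ≤ 1) (k : Fin n → ℤ) :
    ∫⁻ x in halfOpenCube k, ENNReal.ofReal (H x) ≤ 1 := by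
  calc ∫⁻ x in halfOpenCube k, ENNReal.ofReal (H x) ≤ ∫⁻ _ in halfOpenCube k, 1 :=
        lintegral_mono fun x => by simpa using hH x
    _ = 1 := by simp [volume_halfOpenCube]

/-- A cube centered anywhere meets `cube 0 R` inside a cube of at most the same side-length
that is contained in `cube 0 R`. -/
theorem exists_cube_subset_cube_zero {n : ℕ} {r R : ℝ} (hr : 1 ≤ r) (hR : 1 ≤ R)
    (x : EuclideanSpace ℝ (Fin n)) :
    ∃ (x' : EuclideanSpace ℝ (Fin n)) (r' : ℝ), 1 ≤ r' ∧ r' ≤ r ∧ cube x' r' ⊆ cube 0 R ∧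
      cube x r ∩ cube 0 R ⊆ cube x' r' := by
  rcases le_total R r with h | hrR
  · exact ⟨0, R, hR, h, subset_rfl, Set.inter_subset_right⟩
  -- Each coordinate of the center is clamped to `[-(R - r)/2, (R - r)/2]`, the range in which a
  -- cube of side `r` fits inside `cube 0 R`.
  refine ⟨WithLp.toLp 2 fun i => max (-((R - r) / 2)) (min ((R - r) / 2) (x i)), r, hr, le_rfl,
    ?_, ?_⟩
  · intro y hy i
    have := hy i
    simp only [PiLp.zero_apply, abs_le] at this ⊢
    rcases max_cases (-((R - r) / 2)) (min ((R - r) / 2) (x i)) with h | h <;>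
    rcases min_cases ((R - r) / 2) (x i) with h' | h' <;>
    constructor <;> linarith
  · intro y hy i
    have h1 := hy.1 i
    have h2 := hy.2 i
    simp only [PiLp.zero_apply, abs_le] at h1 h2 ⊢
    rcases max_cases (-((R - r) / 2)) (min ((R - r) / 2) (x i)) with h | h <;>
    rcases min_cases ((R - r) / 2) (x i) with h' | h' <;>
    constructor <;> linarith

/-- The indicator function of a union of lattice cubes in `cube 0 R` has fractal constant
at most `4 ^ α γ`. -/
theorem fractalConst_indicator_cubeUnion_le {n : ℕ} {α R : ℝ} (hα : 0 ≤ α) (hR : 1 ≤ R)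
    {S : Finset (Fin n → ℤ)} (hS : ∀ k ∈ S, latticeCube k ⊆ cube 0 R) :
    fractalConst α ((cubeUnion S).indicator fun _ => (1 : ℝ)) ≤
      ENNReal.ofReal (4 ^ α) * cubeGamma α R S := by
  classical
  refine sInf_le fun x₀ r hr => ?_
  -- Points of a lattice cube meeting the ball have coordinates within `r + 1 ≤ 2 * r` of those of
  -- `x₀`, hence side `4 * r`.
  obtain ⟨x', r', hr1, hr'r, hx', hsub⟩ :=
    exists_cube_subset_cube_zero (r := 4 * r) (by linarith) hR x₀
  have hcontain : Metric.ball x₀ r ∩ cubeUnion S ⊆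
      ⋃ k ∈ S.filter fun k => latticeCube k ⊆ cube x' r', latticeCube k := by
    rintro y ⟨hy, hyS⟩
    simp only [cubeUnion, Set.mem_iUnion, exists_prop] at hyS ⊢
    obtain ⟨k, hk, hyk⟩ := hyS
    refine ⟨k, Finset.mem_filter.2 ⟨hk, fun z hz => hsub ⟨fun i => ?_, hS k hk hz⟩⟩, hyk⟩
    have h1 : |y i - x₀ i| < r := by
      have := PiLp.norm_apply_le (y - x₀) i
      rw [mem_ball_iff_norm] at hy
      simp only [PiLp.sub_apply, Real.norm_eq_abs] at this
      linarith
    have h2 := hyk i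
    have h3 := hz i
    rw [abs_lt] at h1
    rw [abs_le]
    constructor <;> linarith [h1.1, h1.2, h2.1, h2.2, h3.1, h3.2]
  have hind : ∀ x, ENNReal.ofReal ((cubeUnion S).indicator (fun _ => (1 : ℝ)) x) =
      (cubeUnion S).indicator (fun _ => (1 : ℝ≥0∞)) x := fun x => by
    by_cases hx : x ∈ cubeUnion S <;> simp [hx]
  simp_rw [hind]
  rw [setLIntegral_indicator (measurableSet_cubeUnion S), setLIntegral_one, Set.inter_comm]
  calc volume (Metric.ball x₀ r ∩ cubeUnion S)
      ≤ ∑ k ∈ S.filter fun k => latticeCube k ⊆ cube x' r', volume (latticeCube k) :=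
        (measure_mono hcontain).trans (measure_biUnion_finset_le _ _)
    _ = cubeCount S (cube x' r') := by
        simp only [volume_latticeCube, Finset.sum_const, nsmul_eq_mul, mul_one]
        unfold cubeCount
        congr!
    _ ≤ cubeGamma α R S * ENNReal.ofReal (r' ^ α) := cubeCount_le_cubeGamma_mul S hr1 hx'
    _ ≤ cubeGamma α R S * ENNReal.ofReal ((4 * r) ^ α) := by
        gcongr
    _ = _ := by
        rw [Real.mul_rpow (by norm_num) (by linarith), ENNReal.ofReal_mul (by positivity)]
        ring

/-! ### Local constancy of the extension operator. -/

/-- The kernel `K` of the identity `F t = ∫_a^{a+1} (F s + K s * F' s) ds`. -/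
def unitIntervalKernel (a t s : ℝ) : ℝ := if s < t then s - a else s - a - 1

theorem measurable_unitIntervalKernel (a t : ℝ) : Measurable (unitIntervalKernel a t) :=
  Measurable.ite measurableSet_Iio (by fun_prop) (by fun_prop)

theorem abs_unitIntervalKernel_le {a t s : ℝ} (hs : s ∈ Set.Ico a (a + 1)) :
    |unitIntervalKernel a t s| ≤ 1 := by
  unfold unitIntervalKernel
  rw [abs_le]
  split_ifs <;> constructor <;> linarith [hs.1, hs.2]

/-- The integrand is the derivative of `(s - c) * exp (z * s)`. -/
theorem intervalIntegral_one_add_mul_cexp (z : ℂ) (a b c : ℝ) :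
    ∫ s in a..b, (1 + ((s - c : ℝ) : ℂ) * z) * Complex.exp (z * s) =
      ((b - c : ℝ) : ℂ) * Complex.exp (z * b) - ((a - c : ℝ) : ℂ) * Complex.exp (z * a) := by
  refine intervalIntegral.integral_eq_sub_of_hasDerivAt
    (f := fun s : ℝ => ((s - c : ℝ) : ℂ) * Complex.exp (z * s)) (fun s _ => ?_) ?_
  · have h1 : HasDerivAt (fun s : ℝ => ((s - c : ℝ) : ℂ)) ((1 : ℝ) : ℂ) s :=
      HasDerivAt.ofReal_comp ((hasDerivAt_id s).sub_const c)
    have h2 : HasDerivAt (fun s : ℝ => Complex.exp (z * s)) (Complex.exp (z * s) * (z * 1)) s :=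
      (Complex.ofRealCLM.hasDerivAt.const_mul z).cexp
    refine (h1.mul h2).congr_deriv ?_
    push_cast
    ring
  · exact Continuous.intervalIntegrable (by fun_prop) _ _

/-- Integrate by parts on both sides of `t`, with `c = a` on the left and `c = a + 1` on the right.
The boundary terms at `a` and `a + 1` vanish, and those at `t` add up to `(t - a) - (t - a - 1) =
1`. -/
theorem cexp_eq_setIntegral_Ico (z : ℂ) {a t : ℝ} (ht : t ∈ Set.Icc a (a + 1)) :
    Complex.exp (z * t) = ∫ s in Set.Ico a (a + 1),
      (1 + (unitIntervalKernel a t s : ℂ) * z) * Complex.exp (z * s) := by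
  have e1 : Set.EqOn (fun s : ℝ => (1 + (unitIntervalKernel a t s : ℂ) * z) * Complex.exp (z * s))
      (fun s => (1 + ((s - a : ℝ) : ℂ) * z) * Complex.exp (z * s)) (Set.Ico a t) := fun s hs => by
    simp only [unitIntervalKernel, if_pos hs.2]
  have e2 : Set.EqOn (fun s : ℝ => (1 + (unitIntervalKernel a t s : ℂ) * z) * Complex.exp (z * s))
      (fun s => (1 + ((s - (a + 1) : ℝ) : ℂ) * z) * Complex.exp (z * s)) (Set.Ico t (a + 1)) :=
    fun s hs => by
      simp only [unitIntervalKernel, if_neg hs.1.not_gt, sub_sub]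
  have c1 : IntegrableOn (fun s : ℝ => (1 + ((s - a : ℝ) : ℂ) * z) * Complex.exp (z * s))
      (Set.Ico a t) :=
    (Continuous.integrableOn_Icc (by fun_prop)).mono_set Set.Ico_subset_Icc_self
  have c2 : IntegrableOn (fun s : ℝ => (1 + ((s - (a + 1) : ℝ) : ℂ) * z) * Complex.exp (z * s))
      (Set.Ico t (a + 1)) :=
    (Continuous.integrableOn_Icc (by fun_prop)).mono_set Set.Ico_subset_Icc_self
  rw [← Set.Ico_union_Ico_eq_Ico ht.1 ht.2,
    setIntegral_union (Set.Ico_disjoint_Ico_same) measurableSet_Ico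
      (c1.congr_fun e1.symm measurableSet_Ico) (c2.congr_fun e2.symm measurableSet_Ico),
    setIntegral_congr_fun measurableSet_Ico e1, setIntegral_congr_fun measurableSet_Ico e2,
    integral_Ico_eq_integral_Ioc, integral_Ico_eq_integral_Ioc,
    ← intervalIntegral.integral_of_le ht.1, ← intervalIntegral.integral_of_le ht.2,
    intervalIntegral_one_add_mul_cexp, intervalIntegral_one_add_mul_cexp]
  push_cast
  ring

/-- `-2πi` times the point `(ω, |ω|²)` of the unit paraboloid. -/
def paraboloidFrequency {d : ℕ} (ω : EuclideanSpace ℝ (Fin d)) (i : Fin (d + 1)) : ℂ :=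
  -2 * Real.pi * Complex.I * ((Fin.snoc (α := fun _ => ℝ) ω.ofLp (‖ω‖ ^ 2) i : ℝ) : ℂ)

theorem continuous_paraboloidFrequency {d : ℕ} (i : Fin (d + 1)) :
    Continuous fun ω : EuclideanSpace ℝ (Fin d) => paraboloidFrequency ω i := by
  unfold paraboloidFrequency
  refine continuous_const.mul (Complex.continuous_ofReal.comp ?_)
  refine Fin.lastCases ?_ (fun j => ?_) i
  · simp only [Fin.snoc_last]
    fun_prop
  · simp only [Fin.snoc_castSucc]
    fun_prop

theorem norm_paraboloidFrequency_le {d : ℕ} {ω : EuclideanSpace ℝ (Fin d)}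
    (hω : ω ∈ Metric.closedBall 0 1) (i : Fin (d + 1)) :
    ‖paraboloidFrequency ω i‖ ≤ 2 * Real.pi := by
  have h1 : ‖ω‖ ≤ 1 := by simpa using hω
  have h2 : |(Fin.snoc (α := fun _ => ℝ) ω.ofLp (‖ω‖ ^ 2) i : ℝ)| ≤ 1 := by
    refine Fin.lastCases ?_ (fun j => ?_) i
    · simp only [Fin.snoc_last]
      rw [abs_of_nonneg (by positivity)]
      exact pow_le_one₀ (norm_nonneg _) h1
    · simp only [Fin.snoc_castSucc]
      exact (PiLp.norm_apply_le ω j).trans h1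
  unfold paraboloidFrequency
  simp only [norm_mul, norm_neg, Complex.norm_real, Complex.norm_I, Complex.norm_ofNat,
    Real.norm_eq_abs, abs_of_pos Real.pi_pos, mul_one]
  exact mul_le_of_le_one_right (by positivity) h2

theorem norm_cexp_paraboloidFrequency_mul {d : ℕ} (ω : EuclideanSpace ℝ (Fin d))
    (i : Fin (d + 1)) (t : ℝ) : ‖Complex.exp (paraboloidFrequency ω i * t)‖ = 1 := by
  unfold paraboloidFrequency
  convert Complex.norm_exp_ofReal_mul_I
    (-2 * Real.pi * (Fin.snoc (α := fun _ => ℝ) ω.ofLp (‖ω‖ ^ 2) i : ℝ) * t) using 3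
  push_cast
  ring

/-- The character is factored over the coordinates so that the one-variable identity applies to each
factor. -/
theorem paraboloidExtension_eq {d : ℕ} (f : EuclideanSpace ℝ (Fin d) → ℂ)
    (x : EuclideanSpace ℝ (Fin (d + 1))) :
    paraboloidExtension f x = ∫ ω, (∏ i, Complex.exp (paraboloidFrequency ω i * x i)) * f ω
      ∂unitBallMeasure d := by
  unfold paraboloidExtension unitBallMeasure
  congr 1
  funext ω
  congr 1
  rw [← Complex.exp_sum, Fin.sum_univ_castSucc]
  congr 1
  simp only [paraboloidFrequency, Fin.snoc_castSucc, Fin.snoc_last]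
  push_cast
  rw [mul_add, Finset.mul_sum]
  congr 1
  · exact Finset.sum_congr rfl fun i _ => by ring
  · ring

instance isFiniteMeasure_unitBallMeasure (d : ℕ) : IsFiniteMeasure (unitBallMeasure d) :=
  ⟨by simpa [unitBallMeasure] using measure_closedBall_lt_top⟩

theorem continuous_paraboloidExtension {d : ℕ} {f : EuclideanSpace ℝ (Fin d) → ℂ}
    (hf : Integrable f (unitBallMeasure d)) : Continuous (paraboloidExtension f) := by
  simp_rw [funext (paraboloidExtension_eq f)]
  have h := continuous_paraboloidFrequency (d := d)
  refine continuous_of_dominated (bound := fun ω => ‖f ω‖) (fun x => ?_) (fun x => ?_) hf.norm ?_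
  · exact (Continuous.aestronglyMeasurable (by fun_prop)).mul hf.aestronglyMeasurable
  · refine Filter.Eventually.of_forall fun ω => ?_
    simp [norm_cexp_paraboloidFrequency_mul]
  · refine Filter.Eventually.of_forall fun ω => ?_
    fun_prop

/-- The function `f` multiplied by the product of the frequencies in `T`; its extension is a
mixed partial derivative of the extension of `f`. -/
def mulFrequencies {d : ℕ} (T : Finset (Fin (d + 1))) (f : EuclideanSpace ℝ (Fin d) → ℂ)
    (ω : EuclideanSpace ℝ (Fin d)) : ℂ :=
  (∏ i ∈ T, paraboloidFrequency ω i) * f ω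

theorem ae_norm_mulFrequencies_le {d : ℕ} (T : Finset (Fin (d + 1)))
    (f : EuclideanSpace ℝ (Fin d) → ℂ) :
    ∀ᵐ ω ∂unitBallMeasure d, ‖mulFrequencies T f ω‖ ≤ (2 * Real.pi) ^ (d + 1) * ‖f ω‖ := by
  filter_upwards [ae_restrict_mem measurableSet_closedBall] with ω hω
  rw [mulFrequencies, norm_mul, norm_prod]
  gcongr
  calc ∏ i ∈ T, ‖paraboloidFrequency ω i‖ ≤ ∏ _i ∈ T, 2 * Real.pi :=
        Finset.prod_le_prod (fun _ _ => norm_nonneg _)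
          fun i _ => norm_paraboloidFrequency_le hω i
    _ = (2 * Real.pi) ^ T.card := by simp
    _ ≤ (2 * Real.pi) ^ (d + 1) := by
        refine pow_le_pow_right₀ (by linarith [Real.pi_gt_three]) ?_
        simpa using Finset.card_le_univ T

theorem memLp_mulFrequencies {d : ℕ} {q : ℝ≥0∞} (T : Finset (Fin (d + 1)))
    {f : EuclideanSpace ℝ (Fin d) → ℂ} (hf : MemLp f q (unitBallMeasure d)) :
    MemLp (mulFrequencies T f) q (unitBallMeasure d) := by
  have h := continuous_paraboloidFrequency (d := d)
  exact hf.of_le_mul ((Continuous.aestronglyMeasurable (by fun_prop)).mul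
    hf.aestronglyMeasurable) (ae_norm_mulFrequencies_le T f)

theorem eLpNorm_mulFrequencies_le {d : ℕ} (q : ℝ≥0∞) (T : Finset (Fin (d + 1)))
    (f : EuclideanSpace ℝ (Fin d) → ℂ) :
    eLpNorm (mulFrequencies T f) q (unitBallMeasure d) ≤
      ENNReal.ofReal ((2 * Real.pi) ^ (d + 1)) * eLpNorm f q (unitBallMeasure d) :=
  eLpNorm_le_mul_eLpNorm_of_ae_le_mul (ae_norm_mulFrequencies_le T f) q

/-- Fubini turns the product of the one-variable identities into one integral; expanding `∏ (1 + K i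
* z i)` gives the sum over subsets `T`. -/
theorem prod_cexp_eq_setIntegral {n : ℕ} (z : Fin n → ℂ) {k : Fin n → ℤ}
    {x : EuclideanSpace ℝ (Fin n)} (hx : x ∈ halfOpenCube k) :
    ∏ i, Complex.exp (z i * x i) =
      ∫ s in Set.univ.pi fun i => Set.Ico (k i : ℝ) (k i + 1),
        ∑ T : Finset (Fin n), (∏ i ∈ T, (unitIntervalKernel (k i) (x i) (s i) : ℂ)) *
          ((∏ i, Complex.exp (z i * s i)) * ∏ i ∈ T, z i) := by
  rw [volume_pi, Measure.restrict_pi_pi]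
  rw [Finset.prod_congr rfl fun i _ =>
    cexp_eq_setIntegral_Ico (z i) (Set.Ico_subset_Icc_self (hx i)), ← integral_fintype_prod_eq_prod]
  congr 1
  funext s
  rw [Finset.prod_mul_distrib, Finset.prod_one_add, Finset.powerset_univ, Finset.sum_mul]
  refine Finset.sum_congr rfl fun T _ => ?_
  rw [Finset.prod_mul_distrib]
  ring

/-- Representation of the extension on a unit cube by its mixed partial derivatives. -/
theorem paraboloidExtension_eq_setIntegral {d : ℕ} {f : EuclideanSpace ℝ (Fin d) → ℂ}
    (hf : Integrable f (unitBallMeasure d)) {k : Fin (d + 1) → ℤ}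
    {x : EuclideanSpace ℝ (Fin (d + 1))} (hx : x ∈ halfOpenCube k) :
    paraboloidExtension f x =
      ∫ s in Set.univ.pi fun i => Set.Ico (k i : ℝ) (k i + 1),
        ∑ T : Finset (Fin (d + 1)), (∏ i ∈ T, (unitIntervalKernel (k i) (x i) (s i) : ℂ)) *
          paraboloidExtension (mulFrequencies T f) (WithLp.toLp 2 s) := by
  have hc := continuous_paraboloidFrequency (d := d)
  have hfT : ∀ T, Integrable (mulFrequencies T f) (unitBallMeasure d) := fun T =>
    memLp_one_iff_integrable.1 (memLp_mulFrequencies T (memLp_one_iff_integrable.2 hf))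
  set P : Set (Fin (d + 1) → ℝ) := Set.univ.pi fun i => Set.Ico (k i : ℝ) (k i + 1) with hP
  have hPm : MeasurableSet P := MeasurableSet.univ_pi fun _ => measurableSet_Ico
  have hPv : volume P ≠ ∞ := by
    rw [hP, Real.volume_pi_Ico]; simp
  have : IsFiniteMeasure (volume.restrict P) := ⟨by simpa using hPv.lt_top⟩
  have hK : ∀ T : Finset (Fin (d + 1)), Integrable
      (fun s : Fin (d + 1) → ℝ => ∏ i ∈ T, (unitIntervalKernel (k i) (x i) (s i) : ℂ))
      (volume.restrict P) := fun T => by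
    refine Integrable.of_bound (C := 1) (Measurable.aestronglyMeasurable ?_) ?_
    · refine Finset.measurable_prod _ fun i _ => ?_
      exact Complex.measurable_ofReal.comp
        ((measurable_unitIntervalKernel _ _).comp (measurable_pi_apply i))
    · filter_upwards [ae_restrict_mem hPm] with s hs
      rw [norm_prod]
      refine Finset.prod_le_one (fun _ _ => norm_nonneg _) fun i _ => ?_
      rw [Complex.norm_real]
      exact abs_unitIntervalKernel_le (hs i trivial)
  -- Joint integrability for the exchange of integrals: a unimodular factor times a product of
  -- integrable functions of the separate variables.
  have hG : ∀ T : Finset (Fin (d + 1)), Integrable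
      (fun q : EuclideanSpace ℝ (Fin d) × (Fin (d + 1) → ℝ) =>
        (∏ i, Complex.exp (paraboloidFrequency q.1 i * q.2 i)) *
        (mulFrequencies T f q.1 * ∏ i ∈ T, (unitIntervalKernel (k i) (x i) (q.2 i) : ℂ)))
      ((unitBallMeasure d).prod (volume.restrict P)) := fun T => by
    refine ((hfT T).mul_prod (hK T)).bdd_mul (c := 1)
      (Continuous.aestronglyMeasurable ?_) (Filter.Eventually.of_forall fun q => ?_)
    · refine continuous_finsetProd _ fun i _ => Complex.continuous_exp.comp ?_
      exact ((hc i).comp continuous_fst).mul (Complex.continuous_ofReal.comp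
        ((continuous_apply i).comp continuous_snd))
    · simp [norm_cexp_paraboloidFrequency_mul]
  calc paraboloidExtension f x
      = ∫ ω, (∫ s in P, ∑ T : Finset (Fin (d + 1)),
          (∏ i, Complex.exp (paraboloidFrequency ω i * s i)) *
          (mulFrequencies T f ω * ∏ i ∈ T, (unitIntervalKernel (k i) (x i) (s i) : ℂ)))
          ∂unitBallMeasure d := by
        rw [paraboloidExtension_eq]
        congr 1
        funext ω
        rw [prod_cexp_eq_setIntegral _ hx, ← integral_mul_const]
        congr 1
        funext s
        rw [Finset.sum_mul]
        refine Finset.sum_congr rfl fun T _ => ?_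
        rw [mulFrequencies]
        ring
    _ = ∫ s in P, (∫ ω, ∑ T : Finset (Fin (d + 1)),
          (∏ i, Complex.exp (paraboloidFrequency ω i * s i)) *
          (mulFrequencies T f ω * ∏ i ∈ T, (unitIntervalKernel (k i) (x i) (s i) : ℂ))
          ∂unitBallMeasure d) :=
        integral_integral_swap (integrable_finsetSum _ fun T _ => hG T)
    _ = _ := by
        congr 1
        funext s
        rw [integral_finsetSum]
        · refine Finset.sum_congr rfl fun T _ => ?_
          rw [paraboloidExtension_eq, ← integral_const_mul]
          congr 1
          funext ω
          ring
        · intro T _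
          refine ((hfT T).mul_const _).bdd_mul (c := 1)
            (Continuous.aestronglyMeasurable (by fun_prop))
            (Filter.Eventually.of_forall fun q => ?_)
          simp [norm_cexp_paraboloidFrequency_mul]

/-- The kernels are bounded by `1` on the cube, so the representation leaves a bound independent of
the position of `x` in it. -/
theorem enorm_paraboloidExtension_le {d : ℕ} {f : EuclideanSpace ℝ (Fin d) → ℂ}
    (hf : Integrable f (unitBallMeasure d)) {k : Fin (d + 1) → ℤ}
    {x : EuclideanSpace ℝ (Fin (d + 1))} (hx : x ∈ halfOpenCube k) :
    ‖paraboloidExtension f x‖ₑ ≤ ∑ T : Finset (Fin (d + 1)),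
      ∫⁻ y in halfOpenCube k, ‖paraboloidExtension (mulFrequencies T f) y‖ₑ := by
  have hfT : ∀ T, Integrable (mulFrequencies T f) (unitBallMeasure d) := fun T =>
    memLp_one_iff_integrable.1 (memLp_mulFrequencies T (memLp_one_iff_integrable.2 hf))
  rw [paraboloidExtension_eq_setIntegral hf hx]
  refine (enorm_integral_le_lintegral_enorm _).trans ?_
  rw [← lintegral_finsetSum _ fun T _ => (continuous_paraboloidExtension (hfT T)).enorm.measurable,
    halfOpenCube_eq_preimage, ← (PiLp.volume_preserving_toLp (Fin (d + 1))).setLIntegral_comp_preimage_emb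
    (MeasurableEquiv.toLp 2 (Fin (d + 1) → ℝ)).measurableEmbedding]
  refine setLIntegral_mono' (MeasurableSet.univ_pi fun _ => measurableSet_Ico) fun s hs => ?_
  refine (enorm_sum_le _ _).trans (Finset.sum_le_sum fun T _ => ?_)
  rw [enorm_mul]
  refine mul_le_of_le_one_left' ?_
  rw [← ofReal_norm, ENNReal.ofReal_le_one, norm_prod]
  refine Finset.prod_le_one (fun _ _ => norm_nonneg _) fun i _ => ?_
  rw [Complex.norm_real]
  exact abs_unitIntervalKernel_le (hs i trivial)

/-- Monotonicity of `L^p` norms on a probability space; it is applied on unit cubes. -/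
theorem lintegral_enorm_rpow_le {Ω : Type*} [MeasurableSpace Ω] {μ : Measure Ω}
    [IsProbabilityMeasure μ] {g : Ω → ℂ} (hg : AEStronglyMeasurable g μ) {p : ℝ} (hp : 1 ≤ p) :
    (∫⁻ x, ‖g x‖ₑ ∂μ) ^ p ≤ ∫⁻ x, ‖g x‖ₑ ^ p ∂μ := by
  have h := eLpNorm'_le_eLpNorm'_of_exponent_le one_pos hp μ hg
  rw [lintegral_rpow_enorm_eq_rpow_eLpNorm' (by linarith)]
  refine ENNReal.rpow_le_rpow (le_trans (le_of_eq ?_) h) (by linarith)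
  simp [eLpNorm']

/-- Local constancy of the extension operator at unit scale. -/
theorem enorm_paraboloidExtension_rpow_le {d : ℕ} {f : EuclideanSpace ℝ (Fin d) → ℂ}
    (hf : Integrable f (unitBallMeasure d)) {p : ℝ} (hp : 1 ≤ p) {k : Fin (d + 1) → ℤ}
    {x : EuclideanSpace ℝ (Fin (d + 1))} (hx : x ∈ halfOpenCube k) :
    ‖paraboloidExtension f x‖ₑ ^ p ≤
      (Fintype.card (Finset (Fin (d + 1))) : ℝ≥0∞) ^ (p - 1) * ∑ T : Finset (Fin (d + 1)),
      ∫⁻ y in halfOpenCube k, ‖paraboloidExtension (mulFrequencies T f) y‖ₑ ^ p := by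
  have : IsProbabilityMeasure (volume.restrict (halfOpenCube k)) :=
    ⟨by simp [volume_halfOpenCube]⟩
  have hfT : ∀ T, Integrable (mulFrequencies T f) (unitBallMeasure d) := fun T =>
    memLp_one_iff_integrable.1 (memLp_mulFrequencies T (memLp_one_iff_integrable.2 hf))
  refine (ENNReal.rpow_le_rpow (enorm_paraboloidExtension_le hf hx) (by linarith)).trans ?_
  refine (ENNReal.rpow_sum_le_const_mul_sum_rpow _ _ hp).trans ?_
  rw [Finset.card_univ]
  gcongr with T _
  exact lintegral_enorm_rpow_le
    (continuous_paraboloidExtension (hfT T)).aestronglyMeasurable hp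

/-! ### Dyadic decomposition of the masses. -/

/-- Dyadic decomposition of a number `h ≤ a`. -/
theorem ENNReal.le_tsum_dyadic {a h : ℝ≥0∞} (ha : a ≠ ∞) (hle : h ≤ a) :
    h ≤ ∑' j : ℕ, if a * 2⁻¹ ^ (j + 1) < h then a * 2⁻¹ ^ j else 0 := by
  classical
  rcases eq_or_ne h 0 with rfl | h0
  · exact zero_le
  have ha0 : a ≠ 0 := fun h' => h0 (le_zero_iff.1 (h' ▸ hle))
  have hex : ∃ j : ℕ, a * 2⁻¹ ^ (j + 1) < h := by
    obtain ⟨j, hj⟩ := ENNReal.exists_inv_two_pow_lt (a := h / a) (ENNReal.div_ne_zero.2 ⟨h0, ha⟩)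
    refine ⟨j, lt_of_le_of_lt ?_ (ENNReal.mul_lt_of_lt_div' hj)⟩
    gcongr a * ?_
    exact pow_le_pow_of_le_one zero_le (by simp) (Nat.le_succ j)
  -- The term at the least admissible `j` suffices: `h ≤ a * 2⁻¹ ^ j` by minimality, or by `h ≤ a`
  -- when `j = 0`.
  refine le_trans ?_ (ENNReal.le_tsum (Nat.find hex))
  rw [if_pos (Nat.find_spec hex)]
  rcases hj : Nat.find hex with _ | j
  · simpa using hle
  · exact not_lt.1 (Nat.find_min hex (m := j) (by omega))

/-- With `v = a * 2⁻¹ ^ j` the left side is `(2 * B) ^ (β - δ) * v ^ (1 - β + δ)`, and `a ^ (1 - β)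
* a ^ δ ≤ B ^ δ` restores the power `B ^ β`. Because `δ > 0`, the ratio `2⁻¹ ^ (1 - β + δ)` is below
`1` even for `β = 1`. -/
theorem ENNReal.mul_div_rpow_dyadic_le {a B : ℝ≥0∞} (ha0 : a ≠ 0) (ha1 : a ≤ 1) (haB : a ≤ B)
    {β δ : ℝ} (hβ : β ≤ 1) (hδ : 0 < δ) (hδβ : δ < β) (j : ℕ) :
    a * 2⁻¹ ^ j * (B / (a * 2⁻¹ ^ (j + 1))) ^ (β - δ) ≤
      2 * B ^ β * (2⁻¹ ^ (1 - β + δ)) ^ j := by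
  have hat : a ≠ ∞ := (ha1.trans_lt ENNReal.one_lt_top).ne
  have hq : 0 < β - δ := by linarith
  set u : ℝ≥0∞ := 2⁻¹ ^ j with hu
  have hu0 : u ≠ 0 := by simp [hu]
  have hut : u ≠ ∞ := by simp [hu]
  set v := a * u with hv
  have hv0 : v ≠ 0 := mul_ne_zero ha0 hu0
  have hvt : v ≠ ∞ := ENNReal.mul_ne_top hat hut
  have h1 : B / (a * 2⁻¹ ^ (j + 1)) = 2 * B * v⁻¹ := by
    rw [pow_succ, ← hu, ← mul_assoc, ← hv, div_eq_mul_inv,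
      ENNReal.mul_inv (Or.inl hv0) (Or.inl hvt), inv_inv]
    ring
  have h2 : v = v ^ (1 - β + δ) * v ^ (β - δ) := by
    rw [← ENNReal.rpow_add _ _ hv0 hvt]
    simp
  have h3 : v ^ (β - δ) * (v⁻¹) ^ (β - δ) = 1 := by
    rw [← ENNReal.mul_rpow_of_nonneg _ _ hq.le, ENNReal.mul_inv_cancel hv0 hvt, ENNReal.one_rpow]
  have h4 : a ^ (1 - β + δ) ≤ B ^ δ := by
    rw [ENNReal.rpow_add _ _ ha0 hat]
    calc a ^ (1 - β) * a ^ δ ≤ 1 * B ^ δ := by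
          gcongr
          exact ENNReal.rpow_le_one ha1 (by linarith)
      _ = B ^ δ := one_mul _
  have h5 : u ^ (1 - β + δ) = (2⁻¹ ^ (1 - β + δ)) ^ j := by
    rw [hu, ← ENNReal.rpow_natCast, ← ENNReal.rpow_mul, mul_comm, ENNReal.rpow_mul,
      ENNReal.rpow_natCast]
  have h6 : (2 : ℝ≥0∞) ^ (β - δ) ≤ 2 := by
    conv_rhs => rw [← ENNReal.rpow_one 2]
    exact ENNReal.rpow_le_rpow_of_exponent_le (by norm_num) (by linarith)
  rw [h1, ENNReal.mul_rpow_of_nonneg _ _ hq.le, ENNReal.mul_rpow_of_nonneg _ _ hq.le]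
  calc v * (2 ^ (β - δ) * B ^ (β - δ) * (v⁻¹) ^ (β - δ))
      = (v ^ (1 - β + δ) * v ^ (β - δ)) * (2 ^ (β - δ) * B ^ (β - δ) * (v⁻¹) ^ (β - δ)) := by
        rw [← h2]
    _ = 2 ^ (β - δ) * (B ^ (β - δ) * v ^ (1 - β + δ)) * (v ^ (β - δ) * (v⁻¹) ^ (β - δ)) := by ring
    _ = 2 ^ (β - δ) * (B ^ (β - δ) * (a ^ (1 - β + δ) * u ^ (1 - β + δ))) := by
        rw [h3, mul_one, hv, ENNReal.mul_rpow_of_nonneg _ _ (by linarith : 0 ≤ 1 - β + δ)]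
    _ ≤ 2 * (B ^ (β - δ) * (B ^ δ * u ^ (1 - β + δ))) := by gcongr
    _ = 2 * B ^ β * (2⁻¹ ^ (1 - β + δ)) ^ j := by
        rw [← mul_assoc (B ^ (β - δ)), ← ENNReal.rpow_add_of_nonneg _ _ hq.le hδ.le, h5,
          sub_add_cancel, mul_assoc]

/-- An estimate over unions of lattice cubes implies an estimate for sums weighted by the
masses of the cubes. -/
theorem sum_mass_mul_lintegral_le {n : ℕ} (hn : 1 ≤ n) {α β δ R : ℝ} (hα : 0 ≤ α) (hβ : β ≤ 1)
    (hδ : 0 < δ) (hδβ : δ < β) {H : EuclideanSpace ℝ (Fin n) → ℝ} (hH : ∀ x, H x ≤ 1)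
    {K : Finset (Fin n → ℤ)} {F : EuclideanSpace ℝ (Fin n) → ℝ≥0∞} {L : ℝ≥0∞}
    (hL : ∀ S ⊆ K, ∫⁻ x in cubeUnion S, F x ≤ L * cubeGamma α R S ^ β) :
    ∑ k ∈ K, (∫⁻ x in halfOpenCube k, ENNReal.ofReal (H x)) * ∫⁻ x in halfOpenCube k, F x ≤
      L * (ENNReal.ofReal R ^ n) ^ δ *
        (2 * (ENNReal.ofReal ((n : ℝ) ^ α) * fractalConst α H) ^ β) *
        (1 - 2⁻¹ ^ (1 - β + δ))⁻¹ := by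
  classical
  set B := ENNReal.ofReal ((n : ℝ) ^ α) * fractalConst α H with hB
  set h : (Fin n → ℤ) → ℝ≥0∞ := fun k => ∫⁻ x in halfOpenCube k, ENNReal.ofReal (H x) with hh
  have hhB : ∀ k, h k ≤ B := lintegral_halfOpenCube_le_fractalConst hn H
  rcases eq_or_ne B 0 with hB0 | hB0
  · refine le_trans (le_of_eq ?_) zero_le
    refine Finset.sum_eq_zero fun k _ => ?_
    rw [show (∫⁻ x in halfOpenCube k, ENNReal.ofReal (H x)) = 0 from
      le_zero_iff.1 (hB0 ▸ hhB k), zero_mul]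
  -- Both bounds on the masses are kept: `a ≤ 1` controls `a ^ (1 - β)` and `a ≤ B` controls `a ^
  -- δ`.
  set a := min 1 B with ha
  have ha0 : a ≠ 0 := by
    rw [ha]; exact (lt_min one_pos (pos_iff_ne_zero.2 hB0)).ne'
  have ha1 : a ≤ 1 := min_le_left _ _
  have hat : a ≠ ∞ := (ha1.trans_lt ENNReal.one_lt_top).ne
  have hha : ∀ k, h k ≤ a := fun k => le_min (lintegral_halfOpenCube_le_one hH k) (hhB k)
  -- Superlevel sets, not disjoint layers: only the lower bound on the mass enters the estimate of
  -- `γ`.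
  set S : ℕ → Finset (Fin n → ℤ) := fun j => K.filter fun k => a * 2⁻¹ ^ (j + 1) < h k with hS
  calc ∑ k ∈ K, h k * ∫⁻ x in halfOpenCube k, F x
      ≤ ∑ k ∈ K, (∑' j : ℕ, if a * 2⁻¹ ^ (j + 1) < h k then a * 2⁻¹ ^ j else 0) *
          ∫⁻ x in halfOpenCube k, F x := by
        gcongr with k _
        exact ENNReal.le_tsum_dyadic hat (hha k)
    _ = ∑' j : ℕ, a * 2⁻¹ ^ j * ∑ k ∈ S j, ∫⁻ x in halfOpenCube k, F x := by
        simp_rw [← ENNReal.tsum_mul_right]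
        rw [← Summable.tsum_finsetSum fun _ _ => ENNReal.summable]
        congr 1
        funext j
        rw [hS, Finset.mul_sum, Finset.sum_filter]
        refine Finset.sum_congr rfl fun k _ => ?_
        rw [ite_mul, zero_mul]
    _ ≤ ∑' j : ℕ, L * (ENNReal.ofReal R ^ n) ^ δ * (2 * B ^ β) * (2⁻¹ ^ (1 - β + δ)) ^ j := by
        refine ENNReal.tsum_le_tsum fun j => ?_
        have hc0 : a * 2⁻¹ ^ (j + 1) ≠ 0 := mul_ne_zero ha0 (by simp)
        have hct : a * 2⁻¹ ^ (j + 1) ≠ ∞ := ENNReal.mul_ne_top hat (by simp)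
        -- The share `β - δ` of the exponent uses the mass bound for `γ`, the share `δ` the volume
        -- bound.
        have hg : cubeGamma α R (S j) ^ β ≤
            (B / (a * 2⁻¹ ^ (j + 1))) ^ (β - δ) * (ENNReal.ofReal R ^ n) ^ δ := by
          calc cubeGamma α R (S j) ^ β
              = cubeGamma α R (S j) ^ (β - δ) * cubeGamma α R (S j) ^ δ := by
                rw [← ENNReal.rpow_add_of_nonneg _ _ (by linarith) hδ.le, sub_add_cancel]
            _ ≤ _ := by
                gcongr
                · exact cubeGamma_le_fractalConst_div hn hc0 hct fun k hk =>
                    (Finset.mem_filter.1 hk).2.le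
                · exact cubeGamma_le_ofReal_pow hn hα _
        calc a * 2⁻¹ ^ j * ∑ k ∈ S j, ∫⁻ x in halfOpenCube k, F x
            ≤ a * 2⁻¹ ^ j * (L * ((B / (a * 2⁻¹ ^ (j + 1))) ^ (β - δ) *
                (ENNReal.ofReal R ^ n) ^ δ)) := by
              gcongr
              refine (sum_lintegral_halfOpenCube_le (S j) F).trans
                ((hL (S j) (Finset.filter_subset _ _)).trans ?_)
              gcongr
          _ = L * (ENNReal.ofReal R ^ n) ^ δ *
                (a * 2⁻¹ ^ j * (B / (a * 2⁻¹ ^ (j + 1))) ^ (β - δ)) := by ring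
          _ ≤ L * (ENNReal.ofReal R ^ n) ^ δ * (2 * B ^ β * (2⁻¹ ^ (1 - β + δ)) ^ j) := by
              gcongr L * (ENNReal.ofReal R ^ n) ^ δ * ?_
              exact ENNReal.mul_div_rpow_dyadic_le ha0 ha1 (min_le_right _ _) hβ hδ hδβ j
          _ = _ := by ring
    _ = _ := by rw [ENNReal.tsum_mul_left, ENNReal.tsum_geometric]

/-! ### Covering the ball, and the two implications. -/

/-- A ball is covered by finitely many half-open lattice cubes. -/
theorem exists_cover_ball_halfOpenCube (n : ℕ) {R : ℝ} (hR : 1 ≤ R) :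
    ∃ K : Finset (Fin n → ℤ), (∀ k ∈ K, latticeCube k ⊆ cube 0 (4 * R)) ∧
      Metric.ball (0 : EuclideanSpace ℝ (Fin n)) R ⊆ ⋃ k ∈ K, halfOpenCube k := by
  -- Floors of numbers in `(-R, R)` lie between `-R - 1` and `R`, so the cubes reach at most `R + 1
  -- ≤ 2 * R`, half the side `4 * R`.
  refine ⟨Fintype.piFinset fun _ => Finset.Icc ⌈-R - 1⌉ ⌊R⌋, fun k hk y hy i => ?_, fun y hy => ?_⟩
  · have h1 := Finset.mem_Icc.1 (Fintype.mem_piFinset.1 hk i)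
    rw [Int.ceil_le, Int.le_floor] at h1
    have h2 := hy i
    simp only [PiLp.zero_apply, abs_le]
    constructor <;> linarith [h1.1, h1.2, h2.1, h2.2]
  · simp only [Set.mem_iUnion, exists_prop]
    refine ⟨fun i => ⌊y i⌋, Fintype.mem_piFinset.2 fun i => ?_, mem_halfOpenCube_iff_floor.2 rfl⟩
    have h1 : |y i| < R := (PiLp.norm_apply_le y i).trans_lt (by simpa using hy)
    rw [abs_lt] at h1
    rw [Finset.mem_Icc, Int.ceil_le, Int.le_floor]
    constructor <;> linarith [Int.sub_one_lt_floor (y i), Int.floor_le (y i), h1.1, h1.2]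

/-- The weighted integral over a ball is controlled by sums over unit cubes. -/
theorem lintegral_ball_mul_weight_le {d : ℕ} {f : EuclideanSpace ℝ (Fin d) → ℂ}
    (hf : Integrable f (unitBallMeasure d)) {p : ℝ} (hp : 1 ≤ p)
    {H : EuclideanSpace ℝ (Fin (d + 1)) → ℝ} (hH : AEMeasurable H volume)
    {K : Finset (Fin (d + 1) → ℤ)} {s : Set (EuclideanSpace ℝ (Fin (d + 1)))}
    (hK : s ⊆ ⋃ k ∈ K, halfOpenCube k) :
    ∫⁻ x in s, ‖paraboloidExtension f x‖ₑ ^ p * ENNReal.ofReal (H x) ≤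
      (Fintype.card (Finset (Fin (d + 1))) : ℝ≥0∞) ^ (p - 1) * ∑ T : Finset (Fin (d + 1)),
        ∑ k ∈ K, (∫⁻ x in halfOpenCube k, ENNReal.ofReal (H x)) *
          ∫⁻ x in halfOpenCube k, ‖paraboloidExtension (mulFrequencies T f) x‖ₑ ^ p := by
  calc ∫⁻ x in s, ‖paraboloidExtension f x‖ₑ ^ p * ENNReal.ofReal (H x)
      ≤ ∫⁻ x in ⋃ k ∈ K, halfOpenCube k,
          ‖paraboloidExtension f x‖ₑ ^ p * ENNReal.ofReal (H x) := lintegral_mono_set hK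
    _ = ∑ k ∈ K, ∫⁻ x in halfOpenCube k,
          ‖paraboloidExtension f x‖ₑ ^ p * ENNReal.ofReal (H x) :=
        lintegral_biUnion_finset (pairwiseDisjoint_halfOpenCube _)
          (fun k _ => measurableSet_halfOpenCube k) _
    _ ≤ ∑ k ∈ K, ((Fintype.card (Finset (Fin (d + 1))) : ℝ≥0∞) ^ (p - 1) *
          ∑ T : Finset (Fin (d + 1)), ∫⁻ y in halfOpenCube k,
            ‖paraboloidExtension (mulFrequencies T f) y‖ₑ ^ p) *
          ∫⁻ x in halfOpenCube k, ENNReal.ofReal (H x) := by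
        refine Finset.sum_le_sum fun k _ => ?_
        rw [← lintegral_const_mul'' _ hH.restrict.ennreal_ofReal]
        refine setLIntegral_mono' (measurableSet_halfOpenCube k) fun x hx => ?_
        gcongr
        exact enorm_paraboloidExtension_rpow_le hf hp hx
    _ = _ := by
        rw [Finset.sum_comm, Finset.mul_sum]
        refine Finset.sum_congr rfl fun k _ => ?_
        rw [mul_assoc, Finset.sum_mul]
        congr 1
        exact Finset.sum_congr rfl fun T _ => mul_comm _ _

theorem LatticeEstimate.weightedEstimate {d : ℕ} {α β p : ℝ} (hα : 0 ≤ α) (hβ0 : 0 < β)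
    (hβ1 : β ≤ 1) (hp : 1 ≤ p) (h : LatticeEstimate d α β p) : WeightedEstimate d α β p := by
  intro ε hε
  -- The other half of `ε` pays for the loss `R ^ (n * δ)`.
  obtain ⟨C, hC⟩ := h (ε / 2) (by positivity)
  set n : ℕ := d + 1 with hn
  have hn1 : 1 ≤ n := by omega
  have hn0 : (0 : ℝ) < n := by positivity
  set δ : ℝ := min (β / 2) (ε / (2 * n)) with hδ
  have hδ0 : 0 < δ := by rw [hδ]; positivity
  have hδβ : δ < β := (min_le_left _ _).trans_lt (by linarith)
  have hδε : n * δ ≤ ε / 2 := by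
    calc n * δ ≤ n * (ε / (2 * n)) := by gcongr; exact min_le_right _ _
      _ = ε / 2 := by field_simp
  set N : ℝ≥0∞ := (Fintype.card (Finset (Fin n)) : ℝ≥0∞) with hN
  have hN0 : N ≠ 0 := by simp [hN]
  have hNt : N ≠ ∞ := by simp [hN]
  set D : ℝ≥0∞ := ENNReal.ofReal ((2 * Real.pi) ^ n) with hD
  -- `N ^ (p - 1)` comes from the `p`-th power of a sum over `T`, the further `N` from adding equal
  -- bounds over all `T`. The powers of `4` come from using the lattice estimate at scale `4 * R`.
  set M : ℝ≥0∞ := N ^ (p - 1) * N * (C * ENNReal.ofReal (4 ^ ε) *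
    ENNReal.ofReal (4 ^ (α / (n : ℝ))) * D ^ p * (2 * ENNReal.ofReal ((n : ℝ) ^ α) ^ β) *
    (1 - 2⁻¹ ^ (1 - β + δ))⁻¹) with hM
  have hG : (1 - (2⁻¹ : ℝ≥0∞) ^ (1 - β + δ))⁻¹ ≠ ∞ := by
    rw [ENNReal.inv_ne_top]
    exact (tsub_pos_of_lt (ENNReal.rpow_lt_one (by simp) (by linarith))).ne'
  have hMt : M ≠ ∞ := by
    have h1 := ENNReal.rpow_ne_top_of_nonneg (by linarith : 0 ≤ p - 1) hNt
    have h2 := ENNReal.rpow_ne_top_of_nonneg (by linarith : 0 ≤ p)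
      (ENNReal.ofReal_ne_top : D ≠ ∞)
    have h3 := ENNReal.rpow_ne_top_of_nonneg hβ0.le
      (ENNReal.ofReal_ne_top : ENNReal.ofReal ((n : ℝ) ^ α) ≠ ∞)
    finiteness
  refine ⟨M.toNNReal, fun R hR H hH f hf => ?_⟩
  rw [ENNReal.coe_toNNReal hMt]
  obtain ⟨K, hK, hcover⟩ := exists_cover_ball_halfOpenCube n hR
  have hfi : Integrable f (unitBallMeasure d) := hf.integrable (by simpa using hp)
  refine (lintegral_ball_mul_weight_le hfi hp hH.aemeasurable hcover).trans ?_
  set E : ℝ≥0∞ := eLpNorm f (ENNReal.ofReal p) (unitBallMeasure d) ^ p with hE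
  set A : ℝ≥0∞ := fractalConst α H with hA
  have hR4 : (1 : ℝ) ≤ 4 * R := by linarith
  have hpow : ENNReal.ofReal ((4 * R) ^ (ε / 2)) * (ENNReal.ofReal (4 * R) ^ n) ^ δ ≤
      ENNReal.ofReal (4 ^ ε) * ENNReal.ofReal (R ^ ε) := by
    rw [← ENNReal.ofReal_pow (by linarith), ENNReal.ofReal_rpow_of_nonneg (by positivity) hδ0.le,
      ← ENNReal.ofReal_mul (by positivity), ← ENNReal.ofReal_mul (by positivity),
      ← Real.mul_rpow (by norm_num) (by linarith), ← Real.rpow_natCast, ← Real.rpow_mul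
      (by linarith), ← Real.rpow_add (by linarith)]
    refine ENNReal.ofReal_le_ofReal (Real.rpow_le_rpow_of_exponent_le hR4 ?_)
    linarith
  have hpow' : ENNReal.ofReal ((4 * R) ^ (α / (n : ℝ))) =
      ENNReal.ofReal (4 ^ (α / (n : ℝ))) * ENNReal.ofReal (R ^ (α / (n : ℝ))) := by
    rw [← ENNReal.ofReal_mul (by positivity), Real.mul_rpow (by norm_num) (by linarith)]
  have hterm : ∀ T : Finset (Fin n),
      ∑ k ∈ K, (∫⁻ x in halfOpenCube k, ENNReal.ofReal (H x)) *
          ∫⁻ x in halfOpenCube k, ‖paraboloidExtension (mulFrequencies T f) x‖ₑ ^ p ≤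
      (C * ENNReal.ofReal (4 ^ ε) *
        ENNReal.ofReal (4 ^ (α / (n : ℝ))) * D ^ p * (2 * ENNReal.ofReal ((n : ℝ) ^ α) ^ β) *
        (1 - 2⁻¹ ^ (1 - β + δ))⁻¹) * (ENNReal.ofReal (R ^ ε) * A ^ β *
        ENNReal.ofReal (R ^ (α / (n : ℝ))) * E) := fun T => by
    have hT : eLpNorm (mulFrequencies T f) (ENNReal.ofReal p) (unitBallMeasure d) ^ p ≤
        D ^ p * E := by
      rw [hE, ← ENNReal.mul_rpow_of_nonneg _ _ (by linarith)]
      exact ENNReal.rpow_le_rpow (eLpNorm_mulFrequencies_le _ T f) (by linarith)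
    refine (sum_mass_mul_lintegral_le hn1 (R := 4 * R) (L := C * ENNReal.ofReal ((4 * R) ^ (ε / 2)) *
      ENNReal.ofReal ((4 * R) ^ (α / (n : ℝ))) * (D ^ p * E)) hα hβ1 hδ0 hδβ
      (fun x => (hH.mem_Icc x).2) fun S hS => ?_).trans ?_
    · refine (hC (4 * R) hR4 S (fun k hk => hK k (hS hk)) _ (memLp_mulFrequencies T hf)).trans ?_
      calc _ ≤ C * ENNReal.ofReal ((4 * R) ^ (ε / 2)) * cubeGamma α (4 * R) S ^ β *
            ENNReal.ofReal ((4 * R) ^ (α / (n : ℝ))) * (D ^ p * E) := by gcongr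
        _ = _ := by ring
    · rw [ENNReal.mul_rpow_of_nonneg _ _ hβ0.le, hpow']
      calc _ = (ENNReal.ofReal ((4 * R) ^ (ε / 2)) * (ENNReal.ofReal (4 * R) ^ n) ^ δ) *
            (C * (ENNReal.ofReal (4 ^ (α / (n : ℝ))) * ENNReal.ofReal (R ^ (α / (n : ℝ)))) *
              (D ^ p * E) * (2 * (ENNReal.ofReal ((n : ℝ) ^ α) ^ β * A ^ β)) *
              (1 - 2⁻¹ ^ (1 - β + δ))⁻¹) := by ring
        _ ≤ (ENNReal.ofReal (4 ^ ε) * ENNReal.ofReal (R ^ ε)) *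
            (C * (ENNReal.ofReal (4 ^ (α / (n : ℝ))) * ENNReal.ofReal (R ^ (α / (n : ℝ)))) *
              (D ^ p * E) * (2 * (ENNReal.ofReal ((n : ℝ) ^ α) ^ β * A ^ β)) *
              (1 - 2⁻¹ ^ (1 - β + δ))⁻¹) := by gcongr
        _ = _ := by ring
  calc _ ≤ N ^ (p - 1) * ∑ T : Finset (Fin n), (C * ENNReal.ofReal (4 ^ ε) *
        ENNReal.ofReal (4 ^ (α / (n : ℝ))) * D ^ p * (2 * ENNReal.ofReal ((n : ℝ) ^ α) ^ β) *
        (1 - 2⁻¹ ^ (1 - β + δ))⁻¹) * (ENNReal.ofReal (R ^ ε) * A ^ β *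
        ENNReal.ofReal (R ^ (α / (n : ℝ))) * E) := by
        gcongr with T _
        exact hterm T
    _ = _ := by
        rw [Finset.sum_const, Finset.card_univ, nsmul_eq_mul, hM]
        ring

theorem WeightedEstimate.latticeEstimate {d : ℕ} {α β p : ℝ} (hα : 0 ≤ α) (hβ : 0 ≤ β)
    (h : WeightedEstimate d α β p) : LatticeEstimate d α β p := by
  intro ε hε
  obtain ⟨C, hC⟩ := h ε hε
  set n : ℕ := d + 1 with hn
  have hn1 : (1 : ℝ) ≤ n := by exact_mod_cast (by omega : 1 ≤ n)
  set M : ℝ≥0∞ := C * ENNReal.ofReal ((n : ℝ) ^ ε) * ENNReal.ofReal (4 ^ α) ^ β *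
    ENNReal.ofReal ((n : ℝ) ^ (α / (n : ℝ))) with hM
  have hMt : M ≠ ∞ := by
    have h1 := ENNReal.rpow_ne_top_of_nonneg hβ
      (ENNReal.ofReal_ne_top : ENNReal.ofReal (4 ^ α) ≠ ∞)
    finiteness
  refine ⟨M.toNNReal, fun R hR S hS f hf => ?_⟩
  rw [ENNReal.coe_toNNReal hMt]
  set H : EuclideanSpace ℝ (Fin n) → ℝ := (cubeUnion S).indicator fun _ => (1 : ℝ) with hH
  have hA : fractalConst α H ≤ ENNReal.ofReal (4 ^ α) * cubeGamma α R S :=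
    fractalConst_indicator_cubeUnion_le hα hR hS
  have hw : IsFractalWeight α H := by
    refine ⟨(measurable_const.indicator (measurableSet_cubeUnion S)).aemeasurable, fun x => ?_, ?_⟩
    · by_cases hx : x ∈ cubeUnion S <;> simp [hH, hx]
    · refine hA.trans_lt (ENNReal.mul_lt_top ENNReal.ofReal_lt_top ?_)
      exact (cubeGamma_le_card hα S).trans_lt (ENNReal.natCast_lt_top _)
  -- The weighted estimate is used at radius `n * R`; the resulting powers of `n` are part of `M`.
  have hsub : cubeUnion S ⊆ Metric.ball 0 (n * R) :=
    (Set.iUnion₂_subset hS).trans (cube_subset_ball (by omega) 0 (by linarith))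
  calc ∫⁻ x in cubeUnion S, ‖paraboloidExtension f x‖ₑ ^ p
      = ∫⁻ x in cubeUnion S, ‖paraboloidExtension f x‖ₑ ^ p * ENNReal.ofReal (H x) := by
        refine setLIntegral_congr_fun (measurableSet_cubeUnion S) fun x hx => ?_
        simp [hH, hx]
    _ ≤ ∫⁻ x in Metric.ball 0 (n * R), ‖paraboloidExtension f x‖ₑ ^ p * ENNReal.ofReal (H x) :=
        lintegral_mono_set hsub
    _ ≤ C * ENNReal.ofReal ((n * R) ^ ε) * fractalConst α H ^ β *
          ENNReal.ofReal ((n * R) ^ (α / (n : ℝ))) *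
          eLpNorm f (ENNReal.ofReal p) (unitBallMeasure d) ^ p :=
        hC (n * R) (by nlinarith) H hw f hf
    _ ≤ C * ENNReal.ofReal ((n * R) ^ ε) * (ENNReal.ofReal (4 ^ α) * cubeGamma α R S) ^ β *
          ENNReal.ofReal ((n * R) ^ (α / (n : ℝ))) *
          eLpNorm f (ENNReal.ofReal p) (unitBallMeasure d) ^ p := by gcongr
    _ = _ := by
        rw [ENNReal.mul_rpow_of_nonneg _ _ hβ, Real.mul_rpow (by positivity) (by linarith),
          Real.mul_rpow (by positivity) (by linarith), ENNReal.ofReal_mul (by positivity),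
          ENNReal.ofReal_mul (by positivity), hM]
        ring
end

/-- Here the dimension of the ambient space is `n = d + 1 ≥ 2`. -/
theorem proposition2p1 (n d : ℕ) (hn : 2 ≤ n) (hd : n = d + 1) (α β p : ℝ)
    (hα : 1 ≤ α ∧ α ≤ n) (hβ : 1 / (n : ℝ) ≤ β ∧ β ≤ 2 / (n : ℝ))
    (hp : p = 2 + ((n : ℝ) - α) / ((n : ℝ) - 1) * (2 / (n : ℝ) - β)) :
    LatticeEstimate d α β p ↔ WeightedEstimate d α β p := by
  subst hd
  have hn' : (2 : ℝ) ≤ ((d + 1 : ℕ) : ℝ) := by exact_mod_cast hn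
  have hα0 : 0 ≤ α := by linarith [hα.1]
  have hβ0 : 0 < β := lt_of_lt_of_le (by positivity) hβ.1
  -- Here `n ≥ 2` enters, with `β = 1` possible only for `n = 2`.
  have hβ1 : β ≤ 1 := hβ.2.trans ((div_le_one (by linarith)).2 hn')
  have hp1 : 1 ≤ p := by
    have : 0 ≤ (((d + 1 : ℕ) : ℝ) - α) / (((d + 1 : ℕ) : ℝ) - 1) * (2 / ((d + 1 : ℕ) : ℝ) - β) :=
      mul_nonneg (div_nonneg (by linarith [hα.2]) (by linarith)) (by linarith [hβ.2])
    linarith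
  exact ⟨fun h => h.weightedEstimate hα0 hβ0 hβ1 hp1, fun h => h.latticeEstimate hα0 hβ0.le⟩
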